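/- Let $X$ be a real Banach space with $\dim X\ge 2$ that is uniformly convex of power type: for some $p\in[2,\infty)$ and $K>0$, the modulus of convexity $$\delta_X(\varepsilon)=\inf\{1-\|x+y\|/2:\ \|x\|=\|y\|=1,\ \|x-y\|=\varepsilon\}$$ satisfies $\delta_X(\varepsilon)\ge K\varepsilon^p$ for all $0<\varepsilon\le 2$. Let $\Omega\subseteq X$ be a domain (a nonempty connected open set) and let $w:\Omega\to(0,\infty)$ be a weight function with modulus of continuity $$\nu(s)=\sup\{|w(x)-w(y)|:\ x,y\in\Omega,\ \|x-y\|\le s\},$$ finite for some $s>0$. Let $$d_w(x,y)=\inf_\sigma\int_\sigma w\,\|d\sigma\|\qquad(x,y\in\Omega),$$ where $\sigma$ ranges over the rectifiable paths in $\Omega$ joining $x$ and $y$, and the integral is taken with respect to norm arc length. Assume that $$\limsup_{s\to0+}\frac{\int_0^s\frac{\nu(t)}{t}\,dt}{\nu(s)}<\infty,$$ where the quotient is read as $0$ if $\nu(s)=0$ (this happens for small $s$ only if $w$ is constant). Then every $d_w$-geodesic $\gamma:[0,\ell]\to\Omega$, that is, every path with $d_w(\gamma(s),\gamma(t))=|s-t|$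 for all $s,t\in[0,\ell]$, is $C^1$ on the open interval $(0,\ell)$. -/

import Mathlib

open Set Filter Topology MeasureTheory
open scoped ENNReal

noncomputable section

/-- The modulus of convexity
`δ_X(ε) = inf {1 - ‖x + y‖ / 2 : ‖x‖ = ‖y‖ = 1, ‖x - y‖ = ε}`, for `0 < ε ≤ 2`.
The set is bounded below by `0`, and it is nonempty when `dim X ≥ 2`. -/
def modulusOfConvexity (X : Type*) [NormedAddCommGroup X] [NormedSpace ℝ X] (ε : ℝ) : ℝ :=
  sInf {r : ℝ | ∃ x y : X, ‖x‖ = 1 ∧ ‖y‖ = 1 ∧ ‖x - y‖ = ε ∧ r = 1 - ‖x + y‖ / 2}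

/-- `X` is uniformly convex of power type `p`: there is `K > 0` with `δ_X(ε) ≥ K ε ^ p` for all
`0 < ε ≤ 2` (in particular `δ_X(ε) > 0`, so `X` is uniformly convex). -/
def UniformlyConvexOfPowerType (X : Type*) [NormedAddCommGroup X] [NormedSpace ℝ X]
    (p : ℝ) : Prop :=
  ∃ K : ℝ, 0 < K ∧ ∀ ε : ℝ, 0 < ε → ε ≤ 2 → K * ε ^ p ≤ modulusOfConvexity X ε

section Weighted

variable {X : Type*} [NormedAddCommGroup X]

/-- The modulus of continuity of `w` on `Ω`,
`ν(s) = sup {|w x - w y| : x, y ∈ Ω, ‖x - y‖ ≤ s}`, with values in `[0, ∞]`. -/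
def weightModulus (Ω : Set X) (w : X → ℝ) (s : ℝ) : ℝ≥0∞ :=
  ⨆ x ∈ Ω, ⨆ y ∈ Ω, ⨆ (_ : ‖x - y‖ ≤ s), ENNReal.ofReal |w x - w y|

/-- The Dini-type condition `limsup_{s → 0+} (∫_0^s ν(t) / t dt) / ν(s) < ∞`. The quotient is taken
in `[0, ∞]`, so it is `∞` if the integral diverges while `ν(s)` is finite, and it is `0` in the
degenerate case `0 / 0`, which only occurs if `ν` vanishes near `0`. -/
def DiniTypeCondition (ν : ℝ → ℝ≥0∞) : Prop :=
  limsup (fun s : ℝ => (∫⁻ t in Ioc 0 s, ν t / ENNReal.ofReal t) / ν s) (𝓝[>] (0 : ℝ)) < ∞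

/-- The curve `σ`, restricted to `[0, L]`, is a rectifiable path of norm length `L` in `Ω` from `x`
to `y`, parametrized by norm arc length (the length of `σ` on `[s, t]` is `t - s`). Up to
reparametrization every rectifiable path in `Ω` is of this form. -/
structure IsArcLengthPath (Ω : Set X) (x y : X) (L : ℝ) (σ : ℝ → X) : Prop where
  nonneg : 0 ≤ L
  unitSpeed : HasUnitSpeedOn σ (Icc 0 L)
  mem : ∀ t ∈ Icc 0 L, σ t ∈ Ω
  source : σ 0 = x
  target : σ L = y

/-- The weighted length `ℓ_w(σ) = ∫_σ w ‖dσ‖ = ∫_0^L w(σ(t)) dt` of a path parametrized by norm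
arc length on `[0, L]`. -/
def weightedLength (w : X → ℝ) (L : ℝ) (σ : ℝ → X) : ℝ≥0∞ :=
  ∫⁻ t in Icc 0 L, ENNReal.ofReal (w (σ t))

/-- The weighted distance `d_w(x, y) = inf ℓ_w(σ)`, the infimum over all rectifiable paths `σ` in
`Ω` joining `x` and `y`. -/
def weightedDist (Ω : Set X) (w : X → ℝ) (x y : X) : ℝ≥0∞ :=
  ⨅ (L : ℝ) (σ : ℝ → X) (_ : IsArcLengthPath Ω x y L σ), weightedLength w L σ

/-- `γ : [0, ℓ] → Ω` is a `d_w`-geodesic (with unit `d_w`-speed): an isometric embedding of the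
interval `[0, ℓ]` into `(Ω, d_w)`. -/
structure IsWeightedGeodesic (Ω : Set X) (w : X → ℝ) (ℓ : ℝ) (γ : ℝ → X) : Prop where
  mem : ∀ t ∈ Icc 0 ℓ, γ t ∈ Ω
  dist_eq : ∀ s ∈ Icc 0 ℓ, ∀ t ∈ Icc 0 ℓ, weightedDist Ω w (γ s) (γ t) = ENNReal.ofReal |s - t|

end Weighted

end

/-! The Dini condition makes ν decay geometrically along dyadic scales, like θ^n. At scale 2^(-n)
the metric d_w is therefore w(x)‖·‖ up to a relative error O(θ^n), and chords of a geodesic have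
almost the prescribed length (`IsWeightedGeodesic.abs_mul_norm_sub_le`). Two consecutive chords of
equal parameter length, suitably scaled, are then almost unit vectors whose sum has norm almost 2.
Power type convexity forces them to agree up to O(θ^(n/p)), so dyadic difference quotients change by
that much when the step is halved (`exists_difference_quotient_bound`). The errors are summable and
uniform in the parameter, hence the quotients converge uniformly to a continuous derivative. -/

/-! ### Differentiability from dyadic difference quotients -/

/-- If the dyadic difference quotients of a continuous curve converge at a uniform geometric rate
on an interval, the curve is `C¹` there. -/
theorem contDiffOn_of_dyadic_quotients {X : Type*} [NormedAddCommGroup X] [NormedSpace ℝ X]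
    [CompleteSpace X] {g : ℝ → X} (hg : Continuous g) {a b h E θ : ℝ} (hh : 0 < h)
    (hθ0 : 0 ≤ θ) (hθ : θ < 1)
    (H : ∀ n : ℕ, ∀ t ∈ Ioo a b,
      dist ((h / 2 ^ n)⁻¹ • (g (t + h / 2 ^ n) - g t))
        ((h / 2 ^ (n + 1))⁻¹ • (g (t + h / 2 ^ (n + 1)) - g t)) ≤ E * θ ^ n) :
    ContDiffOn ℝ 1 g (Ioo a b) := by
  set D : ℕ → ℝ → X := fun n t => (h / 2 ^ n)⁻¹ • (g (t + h / 2 ^ n) - g t) with hD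
  -- Only dyadic steps are controlled, so g is recovered through its moving averages G n: they
  -- converge pointwise to g, and their derivatives are exactly D n.
  set G : ℕ → ℝ → X := fun n t => (h / 2 ^ n)⁻¹ • ((∫ u in (0 : ℝ)..(t + h / 2 ^ n), g u) -
    ∫ u in (0 : ℝ)..t, g u) with hG
  have hF : ∀ t, HasDerivAt (fun x => ∫ u in (0 : ℝ)..x, g u) (g t) t := fun t =>
    intervalIntegral.integral_hasDerivAt_right (hg.intervalIntegrable _ _)
      (hg.stronglyMeasurableAtFilter _ _) hg.continuousAt
  have hlim : ∀ t ∈ Ioo a b, ∃ v, Tendsto (fun n => D n t) atTop (𝓝 v) := fun t ht =>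
    cauchySeq_tendsto_of_complete (cauchySeq_of_le_geometric θ E hθ fun n => H n t ht)
  choose! V hV using hlim
  have hE : ∀ t ∈ Ioo a b, 0 ≤ E := fun t ht => by
    have := dist_nonneg.trans (H 0 t ht)
    simpa using this
  have hunif : TendstoUniformlyOn D V atTop (Ioo a b) := by
    rw [Metric.tendstoUniformlyOn_iff]
    intro ε hε
    have h1 : Tendsto (fun n : ℕ => E * θ ^ n / (1 - θ)) atTop (𝓝 0) := by
      simpa using ((tendsto_pow_atTop_nhds_zero_of_lt_one hθ0 hθ).const_mul E).div_const (1 - θ)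
    filter_upwards [h1.eventually (gt_mem_nhds hε)] with n hn t ht
    rw [dist_comm]
    exact (dist_le_of_le_geometric_of_tendsto θ E hθ (fun n => H n t ht) (hV t ht) n).trans_lt hn
  have hstep : Tendsto (fun n : ℕ => h / 2 ^ n) atTop (𝓝[≠] 0) := by
    refine tendsto_nhdsWithin_iff.2 ⟨?_, Eventually.of_forall fun n => ?_⟩
    · have := (tendsto_pow_atTop_nhds_zero_of_lt_one (r := (1 / 2 : ℝ))
        (by norm_num) (by norm_num)).const_mul h
      simpa [div_eq_mul_inv] using this
    · have : 0 < h / 2 ^ n := by positivity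
      exact this.ne'
  have hderiv : ∀ t ∈ Ioo a b, HasDerivAt g (V t) t := fun t ht => by
    refine hasDerivAt_of_tendstoUniformlyOn (f := G) isOpen_Ioo hunif
      (Eventually.of_forall fun n x _ => ?_) (fun x _ => ?_) ht
    · exact (((hF (x + h / 2 ^ n)).comp_add_const x (h / 2 ^ n)).sub (hF x)).const_smul _
    · exact (hF x).tendsto_slope_zero.comp hstep
  have hVc : ContinuousOn V (Ioo a b) := by
    refine hunif.continuousOn (Frequently.of_forall fun n => Continuous.continuousOn ?_)
    simp only [hD]
    fun_prop
  rw [contDiffOn_one_iff_derivWithin isOpen_Ioo.uniqueDiffOn]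
  refine ⟨fun t ht => (hderiv t ht).differentiableAt.differentiableWithinAt, hVc.congr ?_⟩
  intro t ht
  rw [derivWithin_of_isOpen isOpen_Ioo ht, (hderiv t ht).deriv]

/-! ### Power type convexity and chords -/

section Convexity

variable {X : Type*} [NormedAddCommGroup X] [NormedSpace ℝ X]

theorem modulusOfConvexity_le {x y : X} (hx : ‖x‖ = 1) (hy : ‖y‖ = 1) :
    modulusOfConvexity X ‖x - y‖ ≤ 1 - ‖x + y‖ / 2 := by
  refine csInf_le ⟨0, ?_⟩ ⟨x, y, hx, hy, rfl, rfl⟩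
  rintro r ⟨u, v, hu, hv, -, rfl⟩
  have := norm_add_le u v
  linarith

/-- Power type convexity for vectors that are only approximately normalized. -/
theorem norm_sub_le_of_almost_unit {p K : ℝ} (hp : 0 < p) (hK : 0 < K)
    (hX : ∀ ε : ℝ, 0 < ε → ε ≤ 2 → K * ε ^ p ≤ modulusOfConvexity X ε) {x y : X} {e : ℝ}
    (hx : |‖x‖ - 1| ≤ e) (hy : |‖y‖ - 1| ≤ e) (hxy : 2 - e ≤ ‖x + y‖) :
    ‖x - y‖ ≤ 4 * e + (3 * e / (2 * K)) ^ p⁻¹ := by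
  have he : 0 ≤ e := (abs_nonneg _).trans hx
  have hpow : 0 ≤ (3 * e / (2 * K)) ^ p⁻¹ := by positivity
  rcases le_or_gt 1 e with h1 | h1
  · have := norm_sub_le x y
    have := (abs_le.1 hx).2
    have := (abs_le.1 hy).2
    linarith
  have normalize : ∀ z : X, |‖z‖ - 1| ≤ e → ‖‖z‖⁻¹ • z‖ = 1 ∧ ‖z - ‖z‖⁻¹ • z‖ ≤ e := by
    intro z hz
    have hz0 : 0 < ‖z‖ := by
      have := (abs_le.1 hz).1
      linarith
    refine ⟨by rw [norm_smul, norm_inv, norm_norm, inv_mul_cancel₀ hz0.ne'], ?_⟩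
    have : z - ‖z‖⁻¹ • z = (1 - ‖z‖⁻¹) • z := by rw [sub_smul, one_smul]
    rw [this, norm_smul, Real.norm_eq_abs]
    calc |1 - ‖z‖⁻¹| * ‖z‖ = |1 - ‖z‖⁻¹| * |‖z‖| := by rw [abs_norm]
      _ = |‖z‖ - 1| := by rw [← abs_mul, sub_mul, one_mul, inv_mul_cancel₀ hz0.ne']
      _ ≤ e := hz
  obtain ⟨hx1, hx2⟩ := normalize x hx
  obtain ⟨hy1, hy2⟩ := normalize y hy
  set x' := ‖x‖⁻¹ • x
  set y' := ‖y‖⁻¹ • y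
  -- Normalizing costs at most 2e in the norm of the sum, so 1 - ‖x' + y'‖ / 2 ≤ 3e / 2.
  have key : ‖x' - y'‖ ≤ (3 * e / (2 * K)) ^ p⁻¹ := by
    rcases (norm_nonneg (x' - y')).eq_or_lt with h0 | h0
    · rwa [← h0]
    have h2 : ‖x' - y'‖ ≤ 2 := by
      have := norm_sub_le x' y'
      linarith
    have h3 := (hX _ h0 h2).trans (modulusOfConvexity_le hx1 hy1)
    have h4 : ‖x + y‖ ≤ ‖x' + y'‖ + 2 * e := by
      have : x + y = (x' + y') + ((x - x') + (y - y')) := by abel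
      rw [this]
      have := norm_add_le (x' + y') ((x - x') + (y - y'))
      have := norm_add_le (x - x') (y - y')
      linarith
    have h5 : ‖x' - y'‖ ^ p ≤ 3 * e / (2 * K) := by
      rw [le_div_iff₀ (by positivity)]
      linarith
    exact (Real.le_rpow_inv_iff_of_pos h0.le (by positivity) hp).2 h5
  have : x - y = (x' - y') + ((x - x') - (y - y')) := by abel
  rw [this]
  have := norm_add_le (x' - y') ((x - x') - (y - y'))
  have := norm_sub_le (x - x') (y - y')
  linarith

/-- In a space of power type convexity, consecutive difference quotients of a curve whose speed is
nearly `1 / c` at small scales differ little. -/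
theorem exists_difference_quotient_bound {p K : ℝ} (hp : 1 ≤ p) (hK : 0 < K)
    (hX : ∀ ε : ℝ, 0 < ε → ε ≤ 2 → K * ε ^ p ≤ modulusOfConvexity X ε)
    {γ : ℝ → X} {c : ℝ → ℝ} {J : Set ℝ} {m B θ h : ℝ} (hm : 0 < m) (hc : ∀ s ∈ J, m ≤ c s)
    (hB : 0 ≤ B) (hθ0 : 0 ≤ θ) (hθ : θ ≤ 1) (hh : 0 < h)
    (hspeed : ∀ n : ℕ, ∀ s ∈ J, ∀ t ∈ J, |s - t| ≤ h / 2 ^ n →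
      |c s * ‖γ s - γ t‖ - (|s - t|)| ≤ B * θ ^ n * |s - t|)
    (hosc : ∀ n : ℕ, ∀ s ∈ J, ∀ t ∈ J, |s - t| ≤ h / 2 ^ n → |c s - c t| ≤ B * θ ^ n) :
    ∃ E : ℝ, ∀ n : ℕ, ∀ t ∈ J, t + h / 2 ^ (n + 1) ∈ J → t + h / 2 ^ n ∈ J →
      dist ((h / 2 ^ n)⁻¹ • (γ (t + h / 2 ^ n) - γ t))
        ((h / 2 ^ (n + 1))⁻¹ • (γ (t + h / 2 ^ (n + 1)) - γ t)) ≤ E * (θ ^ p⁻¹) ^ n := by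
  -- The last term pays for replacing c t by c (t + k) in the estimate of the long chord, whose
  -- length over k is at most (2 + 2B) / m.
  set B' := 2 * B + B * ((2 + 2 * B) / m) with hB'
  have hB'0 : 0 ≤ B' := by positivity
  refine ⟨(4 * B' + (3 * B' / (2 * K)) ^ p⁻¹) / m, fun n t h0 h1 h2 => ?_⟩
  set k := h / 2 ^ (n + 1) with hk
  have hk0 : 0 < k := by positivity
  have hkn : h / 2 ^ n = 2 * k := by rw [hk, pow_succ]; field_simp
  rw [hkn] at h2 ⊢
  have hs := hspeed n
  have ho := hosc n
  rw [hkn] at hs ho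
  have hω0 : 0 ≤ θ ^ n := by positivity
  have hω1 : θ ^ n ≤ 1 := pow_le_one₀ hθ0 hθ
  set ω := θ ^ n with hω
  have hc0 := hc _ h1
  have hcp : 0 < c (t + k) := hm.trans_le hc0
  have e1 := hs _ h1 _ h0 (by rw [add_sub_cancel_left, abs_of_pos hk0]; linarith)
  have e2 := hs _ h1 _ h2 (by
    rw [show t + k - (t + 2 * k) = -k by ring, abs_neg, abs_of_pos hk0]; linarith)
  have e3 := hs _ h0 _ h2 (by
    rw [show t - (t + 2 * k) = -(2 * k) by ring, abs_neg, abs_of_pos (by positivity)])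
  have e4 := ho _ h1 _ h0 (by rw [add_sub_cancel_left, abs_of_pos hk0]; linarith)
  rw [add_sub_cancel_left, abs_of_pos hk0] at e1
  rw [show t + k - (t + 2 * k) = -k by ring, abs_neg, abs_of_pos hk0, norm_sub_rev] at e2
  rw [show t - (t + 2 * k) = -(2 * k) by ring, abs_neg, abs_of_pos (by positivity : 0 < 2 * k),
    norm_sub_rev] at e3
  -- Both half chords are measured from their common endpoint t + k, so one factor normalizes both.
  set x := (c (t + k) / k) • (γ (t + k) - γ t) with hx
  set y := (c (t + k) / k) • (γ (t + 2 * k) - γ (t + k)) with hy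
  have hck : 0 < c (t + k) / k := by positivity
  have hBB' : B * ω ≤ B' * ω := by
    refine mul_le_mul_of_nonneg_right ?_ hω0
    have : 0 ≤ B * ((2 + 2 * B) / m) := by positivity
    linarith
  have hnear : ∀ r : ℝ, |c (t + k) * r - k| ≤ B * ω * k → |c (t + k) / k * r - 1| ≤ B' * ω := by
    intro r hr
    have : c (t + k) / k * r - 1 = (c (t + k) * r - k) / k := by field_simp
    rw [this, abs_div, abs_of_pos hk0]
    exact ((div_le_iff₀ hk0).2 hr).trans hBB'
  have hxn : |‖x‖ - 1| ≤ B' * ω := by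
    rw [hx, norm_smul, Real.norm_of_nonneg hck.le]
    exact hnear _ e1
  have hyn : |‖y‖ - 1| ≤ B' * ω := by
    rw [hy, norm_smul, Real.norm_of_nonneg hck.le]
    exact hnear _ e2
  have hxy : 2 - B' * ω ≤ ‖x + y‖ := by
    have hsum : x + y = (c (t + k) / k) • (γ (t + 2 * k) - γ t) := by
      rw [hx, hy, ← smul_add]; congr 1; abel
    rw [hsum, norm_smul, Real.norm_of_nonneg hck.le]
    set N := ‖γ (t + 2 * k) - γ t‖ with hN
    have hN0 : 0 ≤ N := norm_nonneg _
    have f1 := (abs_le.1 e3).1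
    have f2 := (abs_le.1 e3).2
    have f3 := (abs_le.1 e4).1
    have hNk : N / k ≤ (2 + 2 * B) / m := by
      rw [div_le_div_iff₀ hk0 hm]
      have g1 : m * N ≤ c t * N := mul_le_mul_of_nonneg_right (hc _ h0) hN0
      have g2 : B * ω ≤ B := mul_le_of_le_one_right hB hω1
      have g3 : B * ω * (2 * k) ≤ B * (2 * k) := mul_le_mul_of_nonneg_right g2 (by positivity)
      linarith
    have f4 : 2 - 2 * (B * ω) ≤ c t * (N / k) := by
      rw [← mul_div_assoc, le_div_iff₀ hk0]
      linarith
    have f5 : (c t - B * ω) * (N / k) ≤ c (t + k) * (N / k) :=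
      mul_le_mul_of_nonneg_right (by linarith) (by positivity)
    have f6 : B * ω * (N / k) ≤ B * ω * ((2 + 2 * B) / m) :=
      mul_le_mul_of_nonneg_left hNk (by positivity)
    have f7 : c (t + k) / k * N = c (t + k) * (N / k) := by ring
    rw [f7, hB']
    linarith
  have hmain := norm_sub_le_of_almost_unit (by linarith) hK hX hxn hyn hxy
  have hθp : ω ≤ (θ ^ p⁻¹) ^ n := by
    refine pow_le_pow_left₀ hθ0 ?_ n
    exact Real.self_le_rpow_of_le_one hθ0 hθ (inv_le_one_of_one_le₀ hp)
  have hpw : (3 * (B' * ω) / (2 * K)) ^ p⁻¹ = (3 * B' / (2 * K)) ^ p⁻¹ * (θ ^ p⁻¹) ^ n := by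
    rw [show 3 * (B' * ω) / (2 * K) = 3 * B' / (2 * K) * ω by ring,
      Real.mul_rpow (by positivity) hω0, hω, Real.rpow_pow_comm hθ0]
  have hdiff : (2 * k)⁻¹ • (γ (t + 2 * k) - γ t) - k⁻¹ • (γ (t + k) - γ t) =
      (-(2 * c (t + k))⁻¹) • (x - y) := by
    have h1 : γ (t + 2 * k) - γ t = (γ (t + 2 * k) - γ (t + k)) + (γ (t + k) - γ t) := by abel
    rw [hx, hy, h1, ← smul_sub, smul_smul]
    have : -(2 * c (t + k))⁻¹ * (c (t + k) / k) = -(2 * k)⁻¹ := by field_simp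
    rw [this]
    have : k⁻¹ = (2 * k)⁻¹ + (2 * k)⁻¹ := by field_simp; norm_num
    rw [this]
    module
  rw [dist_eq_norm, hdiff, norm_smul, norm_neg, norm_inv, Real.norm_of_nonneg (by positivity)]
  calc (2 * c (t + k))⁻¹ * ‖x - y‖ ≤ m⁻¹ * ‖x - y‖ := by
        gcongr
        linarith
    _ ≤ m⁻¹ * (4 * (B' * (θ ^ p⁻¹) ^ n) + (3 * B' / (2 * K)) ^ p⁻¹ * (θ ^ p⁻¹) ^ n) := by
        gcongr
        refine hmain.trans ?_
        rw [hpw]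
        gcongr
    _ = _ := by ring

end Convexity

/-! ### Two-sided bounds for the weighted distance -/

section WeightedDistance

variable {X : Type*} [NormedAddCommGroup X] {Ω : Set X} {w : X → ℝ}

theorem IsArcLengthPath.norm_sub_le {x y : X} {L : ℝ} {σ : ℝ → X}
    (hσ : IsArcLengthPath Ω x y L σ) {t : ℝ} (ht : t ∈ Icc 0 L) : ‖σ t - x‖ ≤ t := by
  have h0 : (0 : ℝ) ∈ Icc 0 L := ⟨le_rfl, hσ.nonneg⟩
  have h1 := eVariationOn.edist_le σ (s := Icc 0 L ∩ Icc 0 t) ⟨ht, ht.1, le_rfl⟩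
    ⟨h0, le_rfl, ht.1⟩
  rw [hσ.unitSpeed h0 ht, hσ.source, edist_dist, dist_eq_norm] at h1
  have := (ENNReal.ofReal_le_ofReal_iff (by simpa using ht.1)).1 h1
  simpa using this

/-- Up to arc length r a path from x stays in the ball of radius r, and its length is at least ‖x -
y‖. The minimum allows y to lie outside the ball where w is controlled. -/
theorem le_weightedDist {x y : X} {m r : ℝ} (hm : ∀ z ∈ Ω, ‖z - x‖ < r → m ≤ w z) :
    ENNReal.ofReal m * ENNReal.ofReal (min r ‖x - y‖) ≤ weightedDist Ω w x y := by
  refine le_iInf fun L => le_iInf fun σ => le_iInf fun hσ => ?_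
  set ρ := min r ‖x - y‖
  have hρL : ρ ≤ L := by
    have := hσ.norm_sub_le ⟨hσ.nonneg, le_rfl⟩
    rw [hσ.target, norm_sub_rev] at this
    exact (min_le_right _ _).trans this
  have hsub : Ico 0 ρ ⊆ Icc 0 L := fun t ht => ⟨ht.1, ht.2.le.trans hρL⟩
  calc ENNReal.ofReal m * ENNReal.ofReal ρ = ∫⁻ _ in Ico 0 ρ, ENNReal.ofReal m := by simp
    _ ≤ ∫⁻ t in Ico 0 ρ, ENNReal.ofReal (w (σ t)) := by
        refine setLIntegral_mono' measurableSet_Ico fun t ht => ENNReal.ofReal_le_ofReal ?_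
        refine hm _ (hσ.mem t (hsub ht)) ((hσ.norm_sub_le (hsub ht)).trans_lt ?_)
        exact ht.2.trans_le (min_le_left _ _)
    _ ≤ weightedLength w L σ := lintegral_mono_set hsub

theorem weightedDist_le {x y : X} {L : ℝ} {σ : ℝ → X} (hσ : IsArcLengthPath Ω x y L σ) :
    weightedDist Ω w x y ≤ weightedLength w L σ :=
  (iInf_le _ L).trans ((iInf_le _ σ).trans (iInf_le _ hσ))

theorem hasUnitSpeedOn_line [NormedSpace ℝ X] (x : X) {u : X} (hu : ‖u‖ = 1) (L : ℝ) :
    HasUnitSpeedOn (fun t : ℝ => x + t • u) (Icc 0 L) := by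
  have hiso : Isometry fun t : ℝ => x + t • u := Isometry.of_dist_eq fun s t => by
    rw [dist_add_left, dist_eq_norm, ← sub_smul, norm_smul, hu, mul_one, dist_eq_norm]
  intro s hs t ht
  rcases le_or_gt s t with hst | hst
  swap
  -- Unit speed is also required for t < s, where both sides vanish.
  · rw [Icc_eq_empty hst.not_ge, inter_empty, NNReal.coe_one, one_mul,
      ENNReal.ofReal_of_nonpos (by linarith)]
    exact eVariationOn.subsingleton _ subsingleton_empty
  have hs' : s ∈ Icc 0 L ∩ Icc s t := ⟨hs, le_rfl, hst⟩
  have ht' : t ∈ Icc 0 L ∩ Icc s t := ⟨ht, hst, le_rfl⟩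
  refine le_antisymm ?_ ?_
  · have h1 := (hiso.lipschitz.lipschitzOnWith (s := univ)).comp_eVariationOn_le
      (f := fun t : ℝ => x + t • u) (g := (id : ℝ → ℝ)) (s := Icc 0 L ∩ Icc s t)
      (mapsTo_univ _ _)
    have h2 := (monotone_id.monotoneOn (Icc 0 L ∩ Icc s t)).eVariationOn_eq hs' ht'
    have h3 : Icc 0 L ∩ Icc s t ∩ Icc s t = Icc 0 L ∩ Icc s t := by
      rw [inter_assoc, inter_self]
    rw [h3] at h2
    rw [h2] at h1
    simpa using h1
  · have := eVariationOn.edist_le (fun t : ℝ => x + t • u) ht' hs'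
    rw [hiso.edist_eq, edist_dist, Real.dist_eq, abs_of_nonneg (by linarith)] at this
    simpa using this

theorem weightedDist_le_of_segment_subset [NormedSpace ℝ X] {x y : X} {M : ℝ}
    (hseg : segment ℝ x y ⊆ Ω) (hM : ∀ z ∈ segment ℝ x y, w z ≤ M) :
    weightedDist Ω w x y ≤ ENNReal.ofReal M * ENNReal.ofReal ‖x - y‖ := by
  rcases eq_or_ne x y with rfl | hxy
  · have hpath : IsArcLengthPath Ω x x 0 fun _ => x := by
      refine ⟨le_rfl, ?_, fun _ _ => hseg (left_mem_segment _ _ _), rfl, rfl⟩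
      rw [Icc_self]
      rintro s rfl t rfl
      rw [eVariationOn.subsingleton _ (subsingleton_singleton.anti inter_subset_left)]
      simp
    refine (weightedDist_le hpath).trans ?_
    simp [weightedLength]
  have hL : 0 < ‖y - x‖ := norm_pos_iff.2 (sub_ne_zero.2 hxy.symm)
  set L := ‖y - x‖ with hLdef
  have hu : ‖L⁻¹ • (y - x)‖ = 1 := by
    rw [norm_smul, norm_inv, norm_norm, inv_mul_cancel₀ hL.ne']
  have hmem : ∀ t ∈ Icc 0 L, x + t • L⁻¹ • (y - x) ∈ segment ℝ x y := by
    intro t ht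
    rw [segment_eq_image']
    refine ⟨t / L, ⟨div_nonneg ht.1 hL.le, div_le_one_of_le₀ ht.2 hL.le⟩, ?_⟩
    simp only [smul_smul, div_eq_mul_inv]
  have hpath : IsArcLengthPath Ω x y L fun t => x + t • L⁻¹ • (y - x) :=
    ⟨hL.le, hasUnitSpeedOn_line x hu L, fun t ht => hseg (hmem t ht), by simp, by
      simp [smul_smul, mul_inv_cancel₀ hL.ne']⟩
  refine (weightedDist_le hpath).trans ?_
  calc weightedLength w L _ ≤ ∫⁻ _ in Icc 0 L, ENNReal.ofReal M :=
        setLIntegral_mono' measurableSet_Icc fun t ht => ENNReal.ofReal_le_ofReal (hM _ (hmem t ht))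
    _ = ENNReal.ofReal M * ENNReal.ofReal ‖x - y‖ := by simp [hLdef, norm_sub_rev]

end WeightedDistance

/-! ### Geometric decay from the Dini condition -/

section Dini

/-- The Dini type condition forces geometric decay of the modulus along dyadic scales. -/
theorem DiniTypeCondition.exists_geometric_bound {ν : ℝ → ℝ≥0∞} (hmono : Monotone ν)
    (hfin : ∃ s : ℝ, 0 < s ∧ ν s ≠ ∞) (h : DiniTypeCondition ν) :
    ∃ s > 0, ∃ θ : ℝ, 0 ≤ θ ∧ θ < 1 ∧ ∃ A : ℝ, 0 ≤ A ∧
      ∀ n : ℕ, ν (s / 2 ^ n) ≤ ENNReal.ofReal (A * θ ^ n) := by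
  obtain ⟨s₀, hs₀, hν₀⟩ := hfin
  obtain ⟨C', hlimC, hC'⟩ := exists_between h
  have hev := eventually_lt_of_limsup_lt hlimC
  obtain ⟨s₁, hs₁, hs₁'⟩ := mem_nhdsGT_iff_exists_Ioo_subset.1 hev
  set C : ℝ := C'.toReal with hCdef
  have hC0 : 0 ≤ C := ENNReal.toReal_nonneg
  set I : ℝ → ℝ≥0∞ := fun s => ∫⁻ t in Ioc 0 s, ν t / ENNReal.ofReal t with hI
  set S := min s₀ (s₁ / 2) with hS
  have hs₁0 : (0 : ℝ) < s₁ := hs₁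
  have hSpos : 0 < S := lt_min hs₀ (by positivity)
  have hνfin : ∀ t ≤ S, ν t ≠ ∞ := fun t ht =>
    ne_top_of_le_ne_top hν₀ (hmono (ht.trans (min_le_left _ _)))
  have hIle : ∀ t, 0 < t → t ≤ S → I t ≤ C' * ν t := by
    intro t ht0 htS
    have h1 : t < s₁ := by
      have := min_le_right s₀ (s₁ / 2)
      linarith
    have h2 : I t / ν t < C' := hs₁' ⟨ht0, h1⟩
    rcases eq_or_ne (ν t) 0 with h0 | h0
    · have : I t = 0 := by
        by_contra hne
        rw [h0, ENNReal.div_zero hne] at h2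
        exact not_top_lt h2
      simp [this]
    · exact (ENNReal.div_le_iff_le_mul (Or.inl h0) (Or.inl (hνfin t htS))).1 h2.le
  have hIfin : ∀ t, 0 < t → t ≤ S → I t ≠ ∞ := fun t h0 h1 =>
    ne_top_of_le_ne_top (ENNReal.mul_ne_top hC'.ne (hνfin t h1)) (hIle t h0 h1)
  -- On (t/2, t] the integrand is at least ν(t/2) / t.
  have hsplit : ∀ t, 0 < t → I (t / 2) + ν (t / 2) * ENNReal.ofReal (1 / 2) ≤ I t := by
    intro t ht
    have hu : Ioc 0 (t / 2) ∪ Ioc (t / 2) t = Ioc 0 t :=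
      Ioc_union_Ioc_eq_Ioc (by positivity) (by linarith)
    have hd : Disjoint (Ioc 0 (t / 2)) (Ioc (t / 2) t) :=
      Set.disjoint_left.2 fun z hz hz' => hz.2.not_gt hz'.1
    simp only [hI]
    rw [← hu, lintegral_union measurableSet_Ioc hd]
    gcongr
    calc ν (t / 2) * ENNReal.ofReal (1 / 2)
        = ν (t / 2) / ENNReal.ofReal t * ENNReal.ofReal (t / 2) := by
          rw [ENNReal.div_eq_inv_mul, mul_comm _ (ν (t / 2)), mul_assoc, ← ENNReal.ofReal_inv_of_pos ht,
            ← ENNReal.ofReal_mul (by positivity)]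
          congr 2
          field_simp
      _ = ∫⁻ _ in Ioc (t / 2) t, ν (t / 2) / ENNReal.ofReal t := by
          simp only [lintegral_const, Measure.restrict_apply_univ, Real.volume_Ioc]
          congr 2
          ring
      _ ≤ ∫⁻ z in Ioc (t / 2) t, ν z / ENNReal.ofReal z := by
          refine setLIntegral_mono' measurableSet_Ioc fun z hz => ?_
          exact ENNReal.div_le_div (hmono hz.1.le) (ENNReal.ofReal_le_ofReal hz.2)
  have hle : ∀ t, 0 < t → t ≤ S → (I t).toReal ≤ C * (ν t).toReal := fun t h0 h1 => by
    rw [hCdef, ← ENNReal.toReal_mul]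
    exact ENNReal.toReal_mono (ENNReal.mul_ne_top hC'.ne (hνfin t h1)) (hIle t h0 h1)
  have hhalf : ∀ t, 0 < t → t ≤ S →
      (I (t / 2)).toReal + (ν (t / 2)).toReal * (1 / 2) ≤ (I t).toReal := fun t h0 h1 => by
    have h2 : t / 2 ≤ S := by linarith
    have := ENNReal.toReal_mono (hIfin t h0 h1) (hsplit t h0)
    rwa [ENNReal.toReal_add (hIfin _ (by positivity) h2)
      (ENNReal.mul_ne_top (hνfin _ h2) ENNReal.ofReal_ne_top), ENNReal.toReal_mul,
      ENNReal.toReal_ofReal (by norm_num)] at this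
  -- From I(t/2) + ν(t/2)/2 ≤ I(t) and I(t/2) ≤ C ν(t/2) follows I(t/2) ≤ θ I(t).
  set θ := 2 * C / (2 * C + 1) with hθ
  have hscale : ∀ n : ℕ, 0 < S / 2 ^ n ∧ S / 2 ^ n ≤ S := fun n =>
    ⟨by positivity, div_le_self hSpos.le (one_le_pow₀ (by norm_num))⟩
  have hnext : ∀ n : ℕ, S / 2 ^ (n + 1) = S / 2 ^ n / 2 := fun n => by
    rw [pow_succ, div_div]
  have hdecay : ∀ n : ℕ, (I (S / 2 ^ n)).toReal ≤ θ ^ n * (I S).toReal := by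
    intro n
    induction n with
    | zero => simp
    | succ n ih =>
      have h1 := hhalf _ (hscale n).1 (hscale n).2
      have h2 := hle _ (hscale (n + 1)).1 (hscale (n + 1)).2
      rw [← hnext] at h1
      have h3 : (I (S / 2 ^ (n + 1))).toReal ≤ θ * (I (S / 2 ^ n)).toReal := by
        rw [hθ, div_mul_eq_mul_div, le_div_iff₀ (by positivity)]
        nlinarith
      refine h3.trans ((mul_le_mul_of_nonneg_left ih (by positivity)).trans_eq ?_)
      ring
  refine ⟨S / 2, by positivity, θ, by positivity, ?_, 2 * (I S).toReal, by positivity, fun n => ?_⟩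
  · rw [hθ, div_lt_one (by positivity)]
    linarith
  have h1 := hhalf _ (hscale n).1 (hscale n).2
  have h2 : S / 2 ^ n / 2 ≤ S := by
    have := hscale n
    linarith
  rw [show S / 2 / 2 ^ n = S / 2 ^ n / 2 by ring, ← ENNReal.ofReal_toReal (hνfin _ h2)]
  refine ENNReal.ofReal_le_ofReal ?_
  have h3 := hdecay n
  have h4 : 0 ≤ (I (S / 2 ^ n / 2)).toReal := ENNReal.toReal_nonneg
  linarith

variable {X : Type*} [NormedAddCommGroup X] {Ω : Set X} {w : X → ℝ}

theorem monotone_weightModulus (Ω : Set X) (w : X → ℝ) : Monotone (weightModulus Ω w) :=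
  fun _ _ hst => iSup₂_mono fun _ _ => iSup₂_mono fun _ _ =>
    iSup_le fun h => le_iSup_of_le (h.trans hst) le_rfl

theorem ofReal_abs_sub_le_weightModulus {x y : X} {s : ℝ} (hx : x ∈ Ω) (hy : y ∈ Ω)
    (h : ‖x - y‖ ≤ s) : ENNReal.ofReal |w x - w y| ≤ weightModulus Ω w s :=
  le_iSup₂_of_le x hx (le_iSup₂_of_le y hy (le_iSup_of_le h le_rfl))

theorem exists_geometric_oscillation_bound
    (hfin : ∃ s : ℝ, 0 < s ∧ weightModulus Ω w s ≠ ∞)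
    (hdini : DiniTypeCondition (weightModulus Ω w)) :
    ∃ s > 0, ∃ θ : ℝ, 0 ≤ θ ∧ θ < 1 ∧ ∃ A : ℝ, 0 ≤ A ∧
      ∀ n : ℕ, ∀ x ∈ Ω, ∀ y ∈ Ω, ‖x - y‖ ≤ s / 2 ^ n → |w x - w y| ≤ A * θ ^ n := by
  obtain ⟨s, hs, θ, hθ0, hθ, A, hA, H⟩ :=
    hdini.exists_geometric_bound (monotone_weightModulus Ω w) hfin
  refine ⟨s, hs, θ, hθ0, hθ, A, hA, fun n x hx y hy hxy => ?_⟩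
  exact (ENNReal.ofReal_le_ofReal_iff (by positivity)).1
    ((ofReal_abs_sub_le_weightModulus hx hy hxy).trans (H n))

end Dini

/-! ### Metric speed of a geodesic -/

section Geodesic

variable {X : Type*} [NormedAddCommGroup X] {Ω : Set X} {w : X → ℝ} {ℓ : ℝ} {γ : ℝ → X}

/-- A weighted geodesic is Lipschitz near a parameter where the weight is bounded below. -/
theorem IsWeightedGeodesic.mul_norm_sub_le (hγ : IsWeightedGeodesic Ω w ℓ γ) {m r s t : ℝ}
    (hs : s ∈ Icc 0 ℓ) (ht : t ∈ Icc 0 ℓ) (hm : ∀ z ∈ Ω, ‖z - γ s‖ < r → m ≤ w z)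
    (hr : |s - t| < m * r) (hr0 : 0 ≤ r) : m * ‖γ s - γ t‖ ≤ |s - t| := by
  have h1 := le_weightedDist (y := γ t) hm
  rw [hγ.dist_eq s hs t ht, ← ENNReal.ofReal_mul' (le_min hr0 (norm_nonneg _)),
    ENNReal.ofReal_le_ofReal_iff (abs_nonneg _)] at h1
  rcases le_total r ‖γ s - γ t‖ with h | h
  · rw [min_eq_left h] at h1
    exact absurd hr h1.not_gt
  · rwa [min_eq_right h] at h1

/-- The speed of a weighted geodesic is close to `1 / w` at small scales. -/
theorem IsWeightedGeodesic.abs_mul_norm_sub_le [NormedSpace ℝ X]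
    (hγ : IsWeightedGeodesic Ω w ℓ γ) {m a ω s t : ℝ}
    (hm : 0 < m) (hw0 : 0 ≤ w (γ s)) (hs : s ∈ Icc 0 ℓ) (ht : t ∈ Icc 0 ℓ)
    (hlip : m * ‖γ s - γ t‖ ≤ |s - t|)
    (hseg : segment ℝ (γ s) (γ t) ⊆ Ω) (hst : |s - t| ≤ m * a)
    (hosc : ∀ z ∈ Ω, ‖z - γ s‖ ≤ a → |w z - w (γ s)| ≤ ω) :
    |w (γ s) * ‖γ s - γ t‖ - (|s - t|)| ≤ ω / m * |s - t| := by
  have hra : ‖γ s - γ t‖ ≤ a := le_of_mul_le_mul_left (hlip.trans hst) hm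
  have ha : 0 ≤ a := (norm_nonneg _).trans hra
  have hω : 0 ≤ ω := by
    have := hosc (γ s) (hγ.mem s hs) (by simpa using ha)
    exact (abs_nonneg _).trans this
  have hlow : (w (γ s) - ω) * ‖γ s - γ t‖ ≤ |s - t| := by
    have h1 := le_weightedDist (y := γ t) (m := w (γ s) - ω) (r := a) (Ω := Ω) (w := w)
      (x := γ s) fun z hz hza => by
        have := (abs_le.1 (hosc z hz hza.le)).1
        linarith
    rwa [hγ.dist_eq s hs t ht, min_eq_right hra, ← ENNReal.ofReal_mul' (norm_nonneg _),
      ENNReal.ofReal_le_ofReal_iff (abs_nonneg _)] at h1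
  -- The straight segment is a competitor, and it stays within distance a of γ s.
  have hup : |s - t| ≤ (w (γ s) + ω) * ‖γ s - γ t‖ := by
    have hM : ∀ z ∈ segment ℝ (γ s) (γ t), w z ≤ w (γ s) + ω := fun z hz => by
      have h1 : ‖z - γ s‖ ≤ a := by
        rw [segment_eq_image'] at hz
        obtain ⟨u, hu, rfl⟩ := hz
        rw [add_sub_cancel_left, norm_smul, Real.norm_of_nonneg hu.1, norm_sub_rev]
        exact (mul_le_of_le_one_left (norm_nonneg _) hu.2).trans hra
      have := (abs_le.1 (hosc z (hseg hz) h1)).2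
      linarith
    have hpos : 0 ≤ w (γ s) + ω := add_nonneg hw0 hω
    have h1 := weightedDist_le_of_segment_subset hseg hM
    rwa [hγ.dist_eq s hs t ht, ← ENNReal.ofReal_mul' (norm_nonneg _),
      ENNReal.ofReal_le_ofReal_iff (by positivity)] at h1
  have h1 : ω * ‖γ s - γ t‖ ≤ ω / m * |s - t| := by
    rw [div_mul_eq_mul_div, le_div_iff₀ hm]
    nlinarith
  rw [abs_le]
  constructor <;> linarith

end Geodesic

/-! ### Localization and conclusion -/

theorem theorem3p1 {X : Type*} [NormedAddCommGroup X] [NormedSpace ℝ X] [CompleteSpace X]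
    (hdim : 2 ≤ Module.rank ℝ X)
    (p : ℝ) (hp : 2 ≤ p) (hX : UniformlyConvexOfPowerType X p)
    (Ω : Set X) (hΩ : IsOpen Ω) (hΩc : IsConnected Ω)
    (w : X → ℝ) (hw : ∀ x ∈ Ω, 0 < w x)
    (hfin : ∃ s : ℝ, 0 < s ∧ weightModulus Ω w s ≠ ∞)
    (hdini : DiniTypeCondition (weightModulus Ω w))
    (ℓ : ℝ) (γ : ℝ → X) (hγ : IsWeightedGeodesic Ω w ℓ γ) :
    ContDiffOn ℝ 1 γ (Ioo 0 ℓ) := by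
  obtain ⟨K, hK, hconv⟩ := hX
  obtain ⟨s₁, hs₁, θ, hθ0, hθ1, A, hA, hosc⟩ := exists_geometric_oscillation_bound hfin hdini
  intro t₀ ht₀
  refine ContDiffAt.contDiffWithinAt ?_
  have hx₀ : γ t₀ ∈ Ω := hγ.mem t₀ ⟨ht₀.1.le, ht₀.2.le⟩
  set x₀ := γ t₀ with hx₀def
  obtain ⟨m, hm, hmw⟩ : ∃ m : ℝ, 0 < m ∧ w x₀ = 2 * m := ⟨w x₀ / 2, half_pos (hw _ hx₀), by ring⟩
  -- Radius 2R for the lower bound on w leaves room for R-balls about points of γ within R of x₀.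
  obtain ⟨R, hR, hball, hwlow⟩ : ∃ R > 0, Metric.ball x₀ R ⊆ Ω ∧
      ∀ z ∈ Ω, ‖z - x₀‖ < 2 * R → m ≤ w z := by
    obtain ⟨R₁, hR₁, hball⟩ := Metric.isOpen_iff.1 hΩ x₀ hx₀
    obtain ⟨n, hn⟩ : ∃ n : ℕ, A * θ ^ n < m := by
      have : Tendsto (fun n : ℕ => A * θ ^ n) atTop (𝓝 0) := by
        simpa using (tendsto_pow_atTop_nhds_zero_of_lt_one hθ0 hθ1).const_mul A
      exact (this.eventually (gt_mem_nhds hm)).exists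
    have hpos : 0 < s₁ / 2 ^ n / 2 := by positivity
    refine ⟨min R₁ (s₁ / 2 ^ n / 2), lt_min hR₁ hpos,
      (Metric.ball_subset_ball (min_le_left _ _)).trans hball, fun z hz hzx => ?_⟩
    have h1 := min_le_right R₁ (s₁ / 2 ^ n / 2)
    have h2 := (abs_le.1 (hosc n z hz x₀ hx₀ (by linarith))).1
    linarith
  obtain ⟨η, hη, hηR, hη0, hηℓ⟩ : ∃ η > 0, 4 * η ≤ m * R ∧ η ≤ t₀ ∧ η ≤ ℓ - t₀ := by
    have hmR : 0 < m * R / 4 := by positivity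
    refine ⟨min (m * R / 4) (min t₀ (ℓ - t₀)),
      lt_min hmR (lt_min ht₀.1 (sub_pos.2 ht₀.2)), ?_, ?_, ?_⟩
    · have := min_le_left (m * R / 4) (min t₀ (ℓ - t₀))
      linarith
    · exact (min_le_right _ _).trans (min_le_left _ _)
    · exact (min_le_right _ _).trans (min_le_right _ _)
  set J := Icc (t₀ - η) (t₀ + η) with hJ
  have hJℓ : J ⊆ Icc 0 ℓ := Icc_subset_Icc (by linarith) (by linarith)
  have ht₀J : t₀ ∈ J := ⟨by linarith, by linarith⟩
  have hdist : ∀ s ∈ J, ∀ t ∈ J, |s - t| < m * R := fun s hs t ht => by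
    have : |s - t| ≤ 2 * η := abs_le.2 ⟨by linarith [hs.1, ht.2], by linarith [hs.2, ht.1]⟩
    linarith
  have hnear : ∀ s ∈ J, ‖γ s - x₀‖ < R := fun s hs => by
    have h1 := hγ.mul_norm_sub_le (hJℓ ht₀J) (hJℓ hs)
      (fun z hz hzx => hwlow z hz (hzx.trans (by linarith))) (hdist _ ht₀J _ hs) hR.le
    rw [norm_sub_rev]
    exact lt_of_mul_lt_mul_left (h1.trans_lt (hdist _ ht₀J _ hs)) hm.le
  have hwJ : ∀ s ∈ J, m ≤ w (γ s) := fun s hs =>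
    hwlow _ (hγ.mem _ (hJℓ hs)) ((hnear s hs).trans (by linarith))
  have hlip : ∀ s ∈ J, ∀ t ∈ J, m * ‖γ s - γ t‖ ≤ |s - t| := fun s hs t ht => by
    refine hγ.mul_norm_sub_le (hJℓ hs) (hJℓ ht) (fun z hz hzx => hwlow z hz ?_)
      (hdist s hs t ht) hR.le
    have h1 := norm_sub_le_norm_sub_add_norm_sub z (γ s) x₀
    have h2 := hnear s hs
    linarith
  have hseg : ∀ s ∈ J, ∀ t ∈ J, segment ℝ (γ s) (γ t) ⊆ Ω := fun s hs t ht =>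
    ((convex_ball x₀ R).segment_subset (mem_ball_iff_norm.2 (hnear s hs))
      (mem_ball_iff_norm.2 (hnear t ht))).trans hball
  -- With h ≤ m s₁, the Lipschitz bound turns parameter scale h / 2^n into norm scale s₁ / 2^n; h ≤
  -- η / 2 keeps t + h / 2^n in J.
  obtain ⟨h, hh, hhs, hhη⟩ : ∃ h > 0, h ≤ m * s₁ ∧ h ≤ η / 2 :=
    ⟨min (m * s₁) (η / 2), lt_min (by positivity) (by positivity), min_le_left _ _,
      min_le_right _ _⟩
  have hscale : ∀ n : ℕ, 0 < h / 2 ^ n ∧ h / 2 ^ n ≤ η / 2 ∧ h / 2 ^ n ≤ m * (s₁ / 2 ^ n) := by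
    intro n
    refine ⟨by positivity, (div_le_self hh.le (one_le_pow₀ (by norm_num))).trans hhη, ?_⟩
    rw [← mul_div_assoc]
    gcongr
  obtain ⟨E, hE⟩ := exists_difference_quotient_bound (γ := γ) (c := fun s => w (γ s)) (J := J)
    (B := A / m + A) (by linarith) hK hconv hm hwJ (by positivity) hθ0 hθ1.le hh
    (fun n s hs t ht hst => by
      refine (hγ.abs_mul_norm_sub_le hm (hm.le.trans (hwJ s hs)) (hJℓ hs) (hJℓ ht) (hlip s hs t ht) (hseg s hs t ht)
        (hst.trans (hscale n).2.2) fun z hz hzs => hosc n z hz _ (hγ.mem _ (hJℓ hs)) hzs).trans ?_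
      refine mul_le_mul_of_nonneg_right ?_ (abs_nonneg _)
      rw [add_mul, mul_div_right_comm]
      exact le_add_of_nonneg_right (by positivity))
    (fun n s hs t ht hst => by
      have h1 : ‖γ s - γ t‖ ≤ s₁ / 2 ^ n :=
        le_of_mul_le_mul_left ((hlip s hs t ht).trans (hst.trans (hscale n).2.2)) hm
      refine (hosc n _ (hγ.mem _ (hJℓ hs)) _ (hγ.mem _ (hJℓ ht)) h1).trans ?_
      rw [add_mul]
      exact le_add_of_nonneg_left (by positivity))
  have hcontJ : ContinuousOn γ J := by
    refine (LipschitzOnWith.of_dist_le_mul (K := m⁻¹.toNNReal)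
      fun s hs t ht => ?_).continuousOn
    rw [dist_eq_norm, Real.dist_eq, Real.coe_toNNReal _ (by positivity), ← div_eq_inv_mul, le_div_iff₀' hm]
    exact hlip s hs t ht
  -- Clamping the parameter to J gives a globally continuous curve.
  set g : ℝ → X := fun t => γ (max (t₀ - η) (min t (t₀ + η))) with hg
  have hgc : Continuous g := hcontJ.comp_continuous (by fun_prop) fun t =>
    ⟨le_max_left _ _, max_le (by linarith) (min_le_right _ _)⟩
  have hgγ : ∀ t ∈ J, g t = γ t := fun t ht => by
    simp only [hg]
    rw [min_eq_left ht.2, max_eq_right ht.1]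
  have hgC : ContDiffOn ℝ 1 g (Ioo (t₀ - η / 2) (t₀ + η / 2)) := by
    refine contDiffOn_of_dyadic_quotients hgc hh (E := E) (θ := θ ^ p⁻¹) (by positivity)
      (Real.rpow_lt_one hθ0 hθ1 (by positivity)) fun n t ht => ?_
    have hadd : ∀ n : ℕ, t + h / 2 ^ n ∈ J := fun n =>
      ⟨by linarith [ht.1, hscale n], by linarith [ht.2, hscale n]⟩
    have htJ : t ∈ J := ⟨by linarith [ht.1], by linarith [ht.2]⟩
    rw [hgγ _ htJ, hgγ _ (hadd n), hgγ _ (hadd (n + 1))]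
    exact hE n t htJ (hadd (n + 1)) (hadd n)
  refine (hgC.contDiffAt (Ioo_mem_nhds (by linarith) (by linarith))).congr_of_eventuallyEq ?_
  filter_upwards [Icc_mem_nhds (by linarith : t₀ - η < t₀) (by linarith : t₀ < t₀ + η)] with t ht
  exact (hgγ t ht).symm
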